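/- Let $d\ge 2$ and $0\le\lambda\le 1$. On $\mathbb C^d\otimes\mathbb C^d$ (Alice holds the first factor, Bob the second) let $\mathbb F|\phi\theta\rangle=|\theta\phi\rangle$ be the flip operator, $\Pi^\pm=(\mathbb I\pm\mathbb F)/2$ the projectors onto the symmetric and antisymmetric subspaces, and $$\rho_W=\frac{2(1-\lambda)}{d(d+1)}\Pi^++\frac{2\lambda}{d(d-1)}\Pi^-$$ the Werner state, which is a density matrix. All logarithms are to base $2$, and $0\log 0=0$. **Notions.** Write $S(\rho)=-\mathrm{tr}(\rho\log\rho)$ and $I(\rho)=S(\rho^A)+S(\rho^B)-S(\rho)$, where $\rho^A,\rho^B$ are the reduced states. For a POVM $\{E_k\}$ of Bob with finitely many outcomes put $p_k=\mathrm{tr}((\mathbb I\otimes E_k)\rho)$, $\rho^A_k=\mathrm{tr}_B((\mathbb I\otimes E_k)\rho)/p_k$ and $S(A|\{E_k\})=\sum_k p_kS(\rho^A_k)$. The classical correlations are $\mathcal C^\leftarrow(\rho)=\max_{\{E_k\}}[S(\rho^A)-S(A|\{E_k\})]$, over all POVMs of Bob, and the quantum discord is $\mathcal D^\leftarrow(\rho)=I(\rho)-\mathcal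 C^\leftarrow(\rho)$. The measurement-induced disturbance is $\mathcal D_{MID}(\rho)=\min\,[I(\rho)-I(\Pi(\rho))]$, where $\Pi(\rho)=\sum_{i,j}(P_i\otimes Q_j)\rho(P_i\otimes Q_j)$ and the minimum runs over the complete rank-one projective measurements $\{P_i\}$, $\{Q_j\}$ onto orthonormal eigenbases of $\rho^A$ and $\rho^B$ respectively. Let $S(\rho\|\sigma)=-S(\rho)-\mathrm{tr}(\rho\log\sigma)$ if $\ker\sigma\subseteq\ker\rho$ and $S(\rho\|\sigma)=+\infty$ otherwise. The relative entropies of quantumness are $\mathcal Q^\leftarrow(\rho)=\min_\sigma S(\rho\|\sigma)$ over the quantum-classical states $\sigma=\sum_i p_i\rho_i\otimes|\eta_i\rangle\langle\eta_i|$ ($\{\eta_i\}$ an orthonormal basis of Bob's space, $p$ a probability distribution, $\rho_i$ density matrices), and $\mathcal Q(\rho)=\min_\sigma S(\rho\|\sigma)$ over those $\sigma$ for which, in addition, the $\rho_i$ commute. **Statement.** 1. For every POVM $\{E_k\}$ of Bob with all $E_k$ of rank one, and every outcome $k$, $$S(\rho^A_k)=S(A|\{E_k\})=-\tfrac{2(1-\lambda)}{d+1}\log\tfrac{2(1-\lambda)}{d+1}-\tfrac{d-1+2\lambda}{d+1}\log\tfrac{d-1+2\lambda}{d^2-1},$$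 and this value is the minimum of $S(A|\{E'_k\})$ over all POVMs of Bob. 2. If Bob projects into any orthonormal basis $\{u_k\}$, then all of Alice's conditional states $\rho^A_k$ are diagonal in the common basis $\{u_k\}$. 3. The maximum in $\mathcal C^\leftarrow(\rho_W)$ is attained, and $$\mathcal D^\leftarrow(\rho_W)=\log(d+1)+\lambda\log\tfrac{\lambda}{d-1}+(1-\lambda)\log\tfrac{1-\lambda}{d+1}-\tfrac{2(1-\lambda)}{d+1}\log(1-\lambda)-\tfrac{d-1+2\lambda}{d+1}\log\tfrac{d-1+2\lambda}{2(d-1)}.$$ 4. The minima in $\mathcal D_{MID}$, $\mathcal Q^\leftarrow$ and $\mathcal Q$ are attained at $\rho=\rho_W$, and $$\mathcal D^\leftarrow(\rho_W)=\mathcal D_{MID}(\rho_W)=\mathcal Q^\leftarrow(\rho_W)=\mathcal Q(\rho_W).$$ Moreover $I(\rho_W)-I(\Pi(\rho_W))=\mathcal D^\leftarrow(\rho_W)$ whenever Alice and Bob dephase in the same orthonormal basis. -/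

import Mathlib

open scoped Kronecker ComplexOrder

noncomputable section

namespace QuantumCorrelations

variable {m n : Type*} [Fintype m] [DecidableEq m] [Fintype n] [DecidableEq n]

/-- Density matrices: positive semidefinite with unit trace. -/
def IsDensity (ρ : Matrix m m ℂ) : Prop :=
  ρ.PosSemidef ∧ ρ.trace = 1

/-- Base-2 logarithm of a Hermitian matrix by functional calculus. The eigenvalue `0` is sent
to `0`, so that `ρ * matrixLog ρ` follows the convention `0 log 0 = 0`. -/
def matrixLog (ρ : Matrix m m ℂ) : Matrix m m ℂ :=
  cfc (Real.logb 2) ρ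

/-- The von Neumann entropy `-tr (ρ log ρ)`, in bits. -/
def entropy (ρ : Matrix m m ℂ) : ℝ :=
  -(ρ * matrixLog ρ).trace.re

open Classical in
/-- The quantum relative entropy `S(ρ‖σ) = -S(ρ) - tr (ρ log σ)`, which is `+∞` unless the
kernel of `σ` is contained in the kernel of `ρ`. -/
def relativeEntropy (ρ σ : Matrix m m ℂ) : EReal :=
  if ∀ v : m → ℂ, σ.mulVec v = 0 → ρ.mulVec v = 0 then
    ((-entropy ρ - (ρ * matrixLog σ).trace.re : ℝ) : EReal)
  else ⊤

/-- Alice's reduced state `tr_B ρ`; Alice holds the first tensor factor. -/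
def traceBob (ρ : Matrix (m × n) (m × n) ℂ) : Matrix m m ℂ :=
  Matrix.of fun i j => ∑ k, ρ (i, k) (j, k)

/-- Bob's reduced state `tr_A ρ`; Bob holds the second tensor factor. -/
def traceAlice (ρ : Matrix (m × n) (m × n) ℂ) : Matrix n n ℂ :=
  Matrix.of fun i j => ∑ k, ρ (k, i) (k, j)

/-- The quantum mutual information `S(ρ^A) + S(ρ^B) - S(ρ^{AB})`. -/
def mutualInfo (ρ : Matrix (m × n) (m × n) ℂ) : ℝ :=
  entropy (traceBob ρ) + entropy (traceAlice ρ) - entropy ρ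

/-! ### Measurements on Bob's system -/

/-- Positive operator valued measures with finitely many outcomes. -/
def IsPOVM {N : ℕ} (E : Fin N → Matrix n n ℂ) : Prop :=
  (∀ k, (E k).PosSemidef) ∧ ∑ k, E k = 1

/-- POVMs all of whose elements have rank one. -/
def IsRankOnePOVM {N : ℕ} (E : Fin N → Matrix n n ℂ) : Prop :=
  IsPOVM E ∧ ∀ k, (E k).rank = 1

/-- Probability `tr ((I ⊗ E) ρ)` of the outcome of Bob's measurement with POVM element `E`. -/
def outcomeProb (ρ : Matrix (m × n) (m × n) ℂ) (E : Matrix n n ℂ) : ℝ :=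
  (((1 : Matrix m m ℂ) ⊗ₖ E) * ρ).trace.re

/-- Alice's conditional state `tr_B ((I ⊗ E) ρ) / p` after Bob's outcome with POVM element `E`
(it is the zero matrix when the outcome has probability `p = 0`). -/
def condState (ρ : Matrix (m × n) (m × n) ℂ) (E : Matrix n n ℂ) : Matrix m m ℂ :=
  (outcomeProb ρ E)⁻¹ • traceBob (((1 : Matrix m m ℂ) ⊗ₖ E) * ρ)

/-- Alice's average conditional entropy `S(A|{E_k}) = ∑ p_k S(ρ^A_k)`. -/
def condEntropy (ρ : Matrix (m × n) (m × n) ℂ) {N : ℕ} (E : Fin N → Matrix n n ℂ) : ℝ :=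
  ∑ k, outcomeProb ρ (E k) * entropy (condState ρ (E k))

/-- The values `S(ρ^A) - S(A|{E_k})` over all POVMs of Bob. -/
def classicalCorrelationValues (ρ : Matrix (m × n) (m × n) ℂ) : Set ℝ :=
  {x | ∃ (N : ℕ) (E : Fin N → Matrix n n ℂ), IsPOVM E ∧
    x = entropy (traceBob ρ) - condEntropy ρ E}

/-- The classical correlations `C^←(ρ)`. -/
def classicalCorrelations (ρ : Matrix (m × n) (m × n) ℂ) : ℝ :=
  sSup (classicalCorrelationValues ρ)

/-- The quantum discord `D^←(ρ) = I(ρ) - C^←(ρ)`, for measurements on Bob's system. -/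
def discord (ρ : Matrix (m × n) (m × n) ℂ) : ℝ :=
  mutualInfo ρ - classicalCorrelations ρ

/-! ### Orthonormal bases -/

/-- The rank-one projector `|u_k⟩⟨u_k|` onto a vector of an orthonormal basis. -/
def basisProj (u : OrthonormalBasis n ℂ (EuclideanSpace ℂ n)) (k : n) : Matrix n n ℂ :=
  Matrix.of fun i j => u k i * star (u k j)

/-- `M` is diagonal in the orthonormal basis `u`. -/
def IsDiagonalIn (u : OrthonormalBasis n ℂ (EuclideanSpace ℂ n)) (M : Matrix n n ℂ) : Prop :=
  ∃ c : n → ℂ, M = ∑ k, c k • basisProj u k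

/-- Dephasing of `ρ` by Alice in the basis `u` and by Bob in the basis `v`:
`∑ (P_i ⊗ Q_j) ρ (P_i ⊗ Q_j)`. -/
def dephase (u : OrthonormalBasis m ℂ (EuclideanSpace ℂ m))
    (v : OrthonormalBasis n ℂ (EuclideanSpace ℂ n))
    (ρ : Matrix (m × n) (m × n) ℂ) : Matrix (m × n) (m × n) ℂ :=
  ∑ i, ∑ j, (basisProj u i ⊗ₖ basisProj v j) * ρ * (basisProj u i ⊗ₖ basisProj v j)

/-- The values `I(ρ) - I(Π(ρ))`, where `Π` is the dephasing in an eigenbasis of `ρ^A` and an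
eigenbasis of `ρ^B`. There are several values if a reduced state has a degenerate spectrum. -/
def midValues (ρ : Matrix (m × n) (m × n) ℂ) : Set ℝ :=
  {x | ∃ (u : OrthonormalBasis m ℂ (EuclideanSpace ℂ m))
      (v : OrthonormalBasis n ℂ (EuclideanSpace ℂ n)),
    IsDiagonalIn u (traceBob ρ) ∧ IsDiagonalIn v (traceAlice ρ) ∧
      x = mutualInfo ρ - mutualInfo (dephase u v ρ)}

/-- The measurement-induced disturbance, minimized over the local eigenbases. -/
def measurementInducedDisturbance (ρ : Matrix (m × n) (m × n) ℂ) : ℝ :=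
  sInf (midValues ρ)

/-! ### Relative entropies of quantumness -/

/-- Quantum-classical states `∑ p_i ρ_i ⊗ |η_i⟩⟨η_i|`. -/
def quantumClassical (m n : Type*) [Fintype m] [DecidableEq m] [Fintype n] [DecidableEq n] :
    Set (Matrix (m × n) (m × n) ℂ) :=
  {σ | ∃ (η : OrthonormalBasis n ℂ (EuclideanSpace ℂ n)) (p : n → ℝ) (r : n → Matrix m m ℂ),
    (∀ i, 0 ≤ p i) ∧ ∑ i, p i = 1 ∧ (∀ i, IsDensity (r i)) ∧
      σ = ∑ i, p i • (r i ⊗ₖ basisProj η i)}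

/-- Fully classical states: quantum-classical states with commuting `ρ_i`. -/
def fullyClassical (m n : Type*) [Fintype m] [DecidableEq m] [Fintype n] [DecidableEq n] :
    Set (Matrix (m × n) (m × n) ℂ) :=
  {σ | ∃ (η : OrthonormalBasis n ℂ (EuclideanSpace ℂ n)) (p : n → ℝ) (r : n → Matrix m m ℂ),
    (∀ i, 0 ≤ p i) ∧ ∑ i, p i = 1 ∧ (∀ i, IsDensity (r i)) ∧
      (∀ i j, Commute (r i) (r j)) ∧
      σ = ∑ i, p i • (r i ⊗ₖ basisProj η i)}

/-- The one-sided relative entropy of quantumness `Q^←(ρ)`. -/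
def oneSidedREQ (ρ : Matrix (m × n) (m × n) ℂ) : EReal :=
  sInf (relativeEntropy ρ '' quantumClassical m n)

/-- The relative entropy of quantumness `Q(ρ)`. -/
def fullREQ (ρ : Matrix (m × n) (m × n) ℂ) : EReal :=
  sInf (relativeEntropy ρ '' fullyClassical m n)

/-! ### Werner states -/

/-- The flip operator on `ℂ^d ⊗ ℂ^d`, `F |φ θ⟩ = |θ φ⟩`. -/
def flip (d : ℕ) : Matrix (Fin d × Fin d) (Fin d × Fin d) ℂ :=
  Matrix.of fun x y => if x = y.swap then 1 else 0

/-- The projector onto the symmetric subspace. -/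
def symProj (d : ℕ) : Matrix (Fin d × Fin d) (Fin d × Fin d) ℂ :=
  (1 / 2 : ℝ) • (1 + flip d)

/-- The projector onto the antisymmetric subspace. -/
def antisymProj (d : ℕ) : Matrix (Fin d × Fin d) (Fin d × Fin d) ℂ :=
  (1 / 2 : ℝ) • (1 - flip d)

/-- The Werner state with parameter `t = tr (ρ Π⁻)`. -/
def wernerState (d : ℕ) (t : ℝ) : Matrix (Fin d × Fin d) (Fin d × Fin d) ℂ :=
  (2 * (1 - t) / (d * (d + 1)) : ℝ) • symProj d + (2 * t / (d * (d - 1)) : ℝ) • antisymProj d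

end QuantumCorrelations

end

/-! The Werner state is `a • 1 + b • flip d` with `a = oneCoeff d t` and `b = flipCoeff d t`, so its
diagonal entry at a product vector of two unit vectors is `a + b * w`, where `w` is the squared
overlap of the factors. All four measures come down to bounding sums of `entropyTerm (a + b * w)`
from below, with weights in `[0, 1]` of prescribed total. By concavity each term lies above its
chord between `w = 0` and `w = 1`, so the sum is smallest when all weights are 0 or 1
(`sum_entropyTerm_ge`, with equality in `sum_entropyTerm_eq`).

For a POVM element `E`, Alice's conditional state is `d * a` times the identity plus `d * b` times
`E / tr E`; the weights are the eigenvalues of `E / tr E`, and they are 0 or 1 when `E` has rank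
one. For dephasing in two bases the weights are the overlaps of the basis vectors, which are 0 or 1
when the bases agree.

For relative entropy, a quantum-classical state is diagonal in a product basis whose Alice part
depends on Bob's index. Gibbs' inequality (`sum_entropyTerm_le_cross`) replaces its eigenvalues by
the diagonal of the Werner state in that basis, and the same concavity bound applies
(`discord_le_relativeEntropy`). The Werner state dephased in a common basis is fully classical and
attains the bound, which settles both relative entropies at once. -/

namespace QuantumCorrelations

open Matrix

/-! ### Functional calculus for combinations of orthogonal projections -/

section Projective

variable {ι n : Type*} [Fintype ι] [DecidableEq ι] [Fintype n] [DecidableEq n]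

/-- Projective measurements: families of mutually orthogonal Hermitian projections which add up
to the identity. Some of them may vanish. -/
structure IsPVM (P : ι → Matrix n n ℂ) : Prop where
  isHermitian : ∀ k, (P k).IsHermitian
  mul_eq : ∀ k l, P k * P l = if k = l then P k else 0
  sum_eq : ∑ k, P k = 1

variable {P : ι → Matrix n n ℂ}

theorem IsPVM.sum_smul_mul_sum_smul (hP : IsPVM P) (x y : ι → ℝ) :
    (∑ k, x k • P k) * (∑ k, y k • P k) = ∑ k, (x k * y k) • P k := by
  simp only [Finset.sum_mul, Finset.mul_sum, smul_mul_assoc, mul_smul_comm, hP.mul_eq]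
  refine Finset.sum_congr rfl fun k _ => ?_
  simp [smul_smul, mul_comm]

theorem IsPVM.sum_smul_mul (hP : IsPVM P) (x : ι → ℝ) (k : ι) :
    (∑ l, x l • P l) * P k = x k • P k := by
  simp [Finset.sum_mul, hP.mul_eq]

theorem IsPVM.isHermitian_sum_smul (hP : IsPVM P) (x : ι → ℝ) :
    (∑ k, x k • P k).IsHermitian := by
  simp only [IsHermitian, conjTranspose_sum, conjTranspose_smul, star_trivial,
    (hP.isHermitian _).eq]

theorem IsPVM.posSemidef (hP : IsPVM P) (k : ι) : (P k).PosSemidef := by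
  have h := posSemidef_conjTranspose_mul_self (P k)
  rwa [(hP.isHermitian k).eq, hP.mul_eq, if_pos rfl] at h

theorem IsPVM.sum_smul_pow (hP : IsPVM P) (x : ι → ℝ) (N : ℕ) :
    (∑ k, x k • P k) ^ N = ∑ k, (x k ^ N) • P k := by
  induction N with
  | zero => simp [hP.sum_eq]
  | succ N ih => rw [pow_succ, ih, hP.sum_smul_mul_sum_smul]; simp [pow_succ]

theorem IsPVM.aeval_sum_smul (hP : IsPVM P) (x : ι → ℝ) (q : Polynomial ℝ) :
    Polynomial.aeval (∑ k, x k • P k) q = ∑ k, q.eval (x k) • P k := by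
  induction q using Polynomial.induction_on' with
  | add p q hp hq => simp [hp, hq, add_smul, Finset.sum_add_distrib]
  | monomial N a =>
    rw [Polynomial.aeval_monomial, hP.sum_smul_pow, ← Algebra.smul_def, Finset.smul_sum]
    simp [smul_smul]

/-- Off the range of `x` the resolvent is explicit: invert each coefficient. Equality can fail,
since a projection may vanish. -/
theorem IsPVM.spectrum_subset (hP : IsPVM P) (x : ι → ℝ) :
    spectrum ℝ (∑ k, x k • P k) ⊆ Set.range x := by
  intro y hy
  by_contra hne
  have hne' : ∀ k, y - x k ≠ 0 := fun k h => hne ⟨k, (sub_eq_zero.mp h).symm⟩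
  apply hy
  rw [spectrum.mem_resolventSet_iff]
  have heq : algebraMap ℝ (Matrix n n ℂ) y - ∑ k, x k • P k = ∑ k, (y - x k) • P k := by
    rw [Algebra.algebraMap_eq_smul_one, ← hP.sum_eq, Finset.smul_sum, ← Finset.sum_sub_distrib]
    simp only [sub_smul]
  rw [heq]
  have h1 : (∑ k, (y - x k) • P k) * (∑ k, (y - x k)⁻¹ • P k) = 1 := by
    rw [hP.sum_smul_mul_sum_smul, ← hP.sum_eq]
    simp [hne']
  have h2 : (∑ k, (y - x k)⁻¹ • P k) * (∑ k, (y - x k) • P k) = 1 := by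
    rw [hP.sum_smul_mul_sum_smul, ← hP.sum_eq]
    simp [hne']
  exact ⟨⟨_, _, h1, h2⟩, rfl⟩

/-- Lagrange interpolation at the values of `x` replaces `g` by a polynomial that agrees with it on
the spectrum. Repeated values of `x` and vanishing projections are therefore harmless, and `g` need
not be continuous. -/
theorem IsPVM.cfc_sum_smul (hP : IsPVM P) (g : ℝ → ℝ) (x : ι → ℝ) :
    cfc g (∑ k, x k • P k) = ∑ k, g (x k) • P k := by
  set q := Lagrange.interpolate (Finset.univ.image x) id g with hq
  have heval : ∀ k, q.eval (x k) = g (x k) := fun k =>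
    Lagrange.eval_interpolate_at_node (s := Finset.univ.image x) (v := id) g
      (Function.injective_id.injOn) (i := x k) (by simp)
  have hsa : IsSelfAdjoint (∑ k, x k • P k) := hP.isHermitian_sum_smul x
  have h1 : cfc g (∑ k, x k • P k) = cfc q.eval (∑ k, x k • P k) := by
    refine cfc_congr fun y hy => ?_
    obtain ⟨k, rfl⟩ := hP.spectrum_subset x hy
    exact (heval k).symm
  rw [h1, cfc_polynomial q _ hsa, hP.aeval_sum_smul]
  simp only [heval]

/-- The summand `-x log x` of the base-2 entropy. -/
noncomputable def entropyTerm (x : ℝ) : ℝ := -(x * Real.logb 2 x)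

theorem IsPVM.entropy_sum_smul (hP : IsPVM P) (x : ι → ℝ) :
    entropy (∑ k, x k • P k) = ∑ k, entropyTerm (x k) * (P k).trace.re := by
  rw [entropy, matrixLog, hP.cfc_sum_smul, hP.sum_smul_mul_sum_smul]
  simp [entropyTerm, trace_sum, trace_smul]

theorem IsPVM.trace_mul_matrixLog (hP : IsPVM P) (x : ι → ℝ) (M : Matrix n n ℂ) :
    (M * matrixLog (∑ k, x k • P k)).trace.re =
      ∑ k, Real.logb 2 (x k) * (M * P k).trace.re := by
  rw [matrixLog, hP.cfc_sum_smul]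
  simp [Finset.mul_sum, trace_sum, trace_smul]

end Projective

/-! ### Rank-one projectors onto orthonormal bases -/

section Bases

theorem basisProj_eq_vecMulVec {n : Type*} [Fintype n]
    (u : OrthonormalBasis n ℂ (EuclideanSpace ℂ n)) (k : n) :
    basisProj u k = vecMulVec (u k) (star (u k : n → ℂ)) := rfl

variable {m n : Type*} [Fintype m] [DecidableEq m] [Fintype n] [DecidableEq n]

theorem star_dotProduct_basis (u : OrthonormalBasis n ℂ (EuclideanSpace ℂ n)) (k l : n) :
    star (u k : n → ℂ) ⬝ᵥ (u l : n → ℂ) = if k = l then 1 else 0 := by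
  have h := orthonormal_iff_ite.mp u.orthonormal k l
  rw [EuclideanSpace.inner_eq_star_dotProduct, dotProduct_comm] at h
  exact h

theorem isPVM_basisProj (u : OrthonormalBasis n ℂ (EuclideanSpace ℂ n)) :
    IsPVM (basisProj u) where
  isHermitian k := by
    rw [basisProj_eq_vecMulVec, IsHermitian, conjTranspose_vecMulVec, star_star]
  mul_eq k l := by
    simp only [basisProj_eq_vecMulVec, vecMulVec_mul_vecMulVec, star_dotProduct_basis]
    split_ifs with h
    · simp [h]
    · simp
  sum_eq := by
    -- Orthonormality reads `Uᴴ * U = 1`; for a square matrix this forces `U * Uᴴ = 1`, which is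
    -- completeness.
    set U : Matrix n n ℂ := Matrix.of fun i k => u k i with hU
    have h1 : Uᴴ * U = 1 := by
      ext k l
      rw [one_apply, ← star_dotProduct_basis u k l]
      rfl
    rw [← mul_eq_one_comm.mp h1]
    ext i j
    simp [Matrix.sum_apply, basisProj, mul_apply, hU]

theorem trace_basisProj (u : OrthonormalBasis n ℂ (EuclideanSpace ℂ n)) (k : n) :
    (basisProj u k).trace = 1 := by
  rw [basisProj_eq_vecMulVec, trace_vecMulVec, dotProduct_comm, star_dotProduct_basis, if_pos rfl]

theorem rank_basisProj (u : OrthonormalBasis n ℂ (EuclideanSpace ℂ n)) (k : n) :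
    (basisProj u k).rank = 1 := by
  apply le_antisymm
  · rw [basisProj_eq_vecMulVec]
    exact rank_vecMulVec_le _ _
  · rw [Nat.one_le_iff_ne_zero]
    intro h
    rw [Matrix.rank, Submodule.finrank_eq_zero, LinearMap.range_eq_bot, ← toLin'_apply',
      LinearEquiv.map_eq_zero_iff] at h
    simpa [h] using trace_basisProj u k

theorem isHermitian_eq_sum_smul_basisProj {A : Matrix n n ℂ} (hA : A.IsHermitian) :
    A = ∑ k, hA.eigenvalues k • basisProj hA.eigenvectorBasis k := by
  have h : A * ∑ k, basisProj hA.eigenvectorBasis k =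
      ∑ k, hA.eigenvalues k • basisProj hA.eigenvectorBasis k := by
    rw [Finset.mul_sum]
    refine Finset.sum_congr rfl fun k _ => ?_
    rw [basisProj_eq_vecMulVec, mul_vecMulVec, hA.mulVec_eigenvectorBasis, smul_vecMulVec]
  rwa [(isPVM_basisProj _).sum_eq, mul_one] at h

/-- Measurements of Alice which depend on the outcome of a projective measurement of Bob. -/
theorem isPVM_conditional {ι κ : Type*} [Fintype ι] [DecidableEq ι] [Fintype κ] [DecidableEq κ]
    {P : κ → ι → Matrix m m ℂ} {Q : κ → Matrix n n ℂ} (hP : ∀ k, IsPVM (P k)) (hQ : IsPVM Q) :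
    IsPVM fun x : ι × κ => P x.2 x.1 ⊗ₖ Q x.2 where
  isHermitian x := by
    rw [IsHermitian, conjTranspose_kronecker, ((hP _).isHermitian _).eq, (hQ.isHermitian _).eq]
  mul_eq x y := by
    rw [← mul_kronecker_mul, hQ.mul_eq]
    obtain ⟨i, k⟩ := x
    obtain ⟨j, l⟩ := y
    by_cases hkl : k = l
    · subst hkl
      simp only [(hP k).mul_eq, Prod.mk.injEq, and_true, if_true]
      split_ifs <;> simp
    · simp [hkl]
  sum_eq := by
    rw [Fintype.sum_prod_type, Finset.sum_comm]
    have h : ∀ k, ∑ i, P k i ⊗ₖ Q k = 1 ⊗ₖ Q k := fun k => by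
      rw [← (hP k).sum_eq]
      ext a b
      simp [Matrix.sum_apply, kroneckerMap_apply, Finset.sum_mul]
    simp only [h]
    rw [← one_kronecker_one (m := m) (n := n), ← hQ.sum_eq]
    ext a b
    simp [Matrix.sum_apply, kroneckerMap_apply, Finset.mul_sum]

end Bases

/-! ### Concavity and Gibbs' inequality for the entropy summand -/

section Real

theorem entropyTerm_eq (x : ℝ) : entropyTerm x = Real.negMulLog x / Real.log 2 := by
  rw [entropyTerm, Real.negMulLog, Real.logb]
  ring

theorem entropyTerm_chord {x y w : ℝ} (hx : 0 ≤ x) (hxy : 0 ≤ x + y) (hw0 : 0 ≤ w)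
    (hw1 : w ≤ 1) :
    w * entropyTerm (x + y) + (1 - w) * entropyTerm x ≤ entropyTerm (x + y * w) := by
  have h := Real.concaveOn_negMulLog.2 (Set.mem_Ici.mpr hxy) (Set.mem_Ici.mpr hx) hw0
    (sub_nonneg.mpr hw1) (by ring)
  simp only [smul_eq_mul] at h
  have e : w * (x + y) + (1 - w) * x = x + y * w := by ring
  rw [e] at h
  simp only [entropyTerm_eq]
  have := div_le_div_of_nonneg_right h (Real.log_pos one_lt_two).le
  calc _ = _ := by ring
    _ ≤ _ := this

/-- Summing the chord bounds leaves only the total weight, so the lower bound is the same for every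
weight family of that total. This is the inequality behind all the optimality claims. -/
theorem sum_entropyTerm_ge {ι : Type*} [Fintype ι] {x y : ℝ} (hx : 0 ≤ x) (hxy : 0 ≤ x + y)
    {w : ι → ℝ} (hw0 : ∀ i, 0 ≤ w i) (hw1 : ∀ i, w i ≤ 1) :
    (∑ i, w i) * entropyTerm (x + y) + (Fintype.card ι - ∑ i, w i) * entropyTerm x ≤
      ∑ i, entropyTerm (x + y * w i) := by
  calc _ = ∑ i, (w i * entropyTerm (x + y) + (1 - w i) * entropyTerm x) := by
        rw [Finset.sum_add_distrib, ← Finset.sum_mul, ← Finset.sum_mul, Finset.sum_sub_distrib]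
        simp
    _ ≤ _ := Finset.sum_le_sum fun i _ => entropyTerm_chord hx hxy (hw0 i) (hw1 i)

/-- Gibbs' inequality. -/
theorem sum_entropyTerm_le_cross {ι : Type*} [Fintype ι] {r q : ι → ℝ} (hr : ∀ i, 0 ≤ r i)
    (hq : ∀ i, 0 ≤ q i) (h0 : ∀ i, q i = 0 → r i = 0) (hsum : ∑ i, q i = ∑ i, r i) :
    ∑ i, entropyTerm (r i) ≤ -∑ i, Real.logb 2 (q i) * r i := by
  have hl : 0 < Real.log 2 := Real.log_pos one_lt_two
  -- For `r i > 0` this is `log s ≤ s - 1` at `s = q i / r i`, multiplied by `r i`; for `r i = 0` it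
  -- says `0 ≤ q i`. Equal totals cancel the right-hand sides after summation.
  have key : ∀ i, (r i * Real.log (q i) - r i * Real.log (r i)) ≤ q i - r i := fun i => by
    rcases (hr i).eq_or_lt with h | h
    · simp [← h, hq i]
    · have hq' : 0 < q i := lt_of_le_of_ne (hq i) fun h' => h.ne' (h0 i h'.symm)
      have h1 := Real.log_le_sub_one_of_pos (div_pos hq' h)
      rw [Real.log_div hq'.ne' h.ne'] at h1
      have h2 := mul_le_mul_of_nonneg_left h1 h.le
      have h3 : r i * (q i / r i - 1) = q i - r i := by field_simp
      linarith
  have h := Finset.sum_le_sum fun i (_ : i ∈ Finset.univ) => key i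
  rw [Finset.sum_sub_distrib, Finset.sum_sub_distrib, hsum, sub_self] at h
  have e1 : ∑ i, entropyTerm (r i) = -(∑ i, r i * Real.log (r i)) / Real.log 2 := by
    simp only [entropyTerm_eq, Real.negMulLog, neg_mul]
    rw [← Finset.sum_div, Finset.sum_neg_distrib]
  have e2 : -∑ i, Real.logb 2 (q i) * r i = -(∑ i, r i * Real.log (q i)) / Real.log 2 := by
    simp only [Real.logb]
    rw [neg_div, Finset.sum_div]
    congr 1
    exact Finset.sum_congr rfl fun i _ => by ring
  rw [e1, e2]
  exact div_le_div_of_nonneg_right (by linarith) hl.le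

end Real

/-! ### Squared overlaps of two orthonormal bases -/

section Overlap

/-- A rank-one projector compresses any matrix to a scalar multiple of itself, so dephasing keeps
only diagonal entries. -/
theorem basisProj_kronecker_mul_mul {m n : Type*} [Fintype m] [Fintype n]
    (u : OrthonormalBasis m ℂ (EuclideanSpace ℂ m))
    (v : OrthonormalBasis n ℂ (EuclideanSpace ℂ n)) (i : m) (j : n)
    (M : Matrix (m × n) (m × n) ℂ) :
    (basisProj u i ⊗ₖ basisProj v j) * M * (basisProj u i ⊗ₖ basisProj v j) =
      (M * (basisProj u i ⊗ₖ basisProj v j)).trace • (basisProj u i ⊗ₖ basisProj v j) := by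
  have h : basisProj u i ⊗ₖ basisProj v j =
      vecMulVec (fun x : m × n => u i x.1 * v j x.2)
        (fun x : m × n => star (u i x.1) * star (v j x.2)) := by
    ext x y
    simp only [kroneckerMap_apply, basisProj, of_apply, vecMulVec_apply]
    ring
  rw [h, mul_assoc, mul_vecMulVec, vecMulVec_mul_vecMulVec, trace_vecMulVec, dotProduct_comm,
    vecMulVec_smul]

variable {n : Type*} [Fintype n]

theorem trace_basisProj_mul_basisProj (u v : OrthonormalBasis n ℂ (EuclideanSpace ℂ n))
    (i j : n) :
    (basisProj u i * basisProj v j).trace =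
      (Complex.normSq (star (u i : n → ℂ) ⬝ᵥ (v j : n → ℂ)) : ℂ) := by
  rw [basisProj_eq_vecMulVec, basisProj_eq_vecMulVec, vecMulVec_mul_vecMulVec, vecMulVec_smul, trace_smul,
    trace_vecMulVec, Complex.normSq_eq_conj_mul_self, smul_eq_mul, mul_comm]
  congr 1
  rw [starRingEnd_apply, dotProduct_comm]
  exact star_dotProduct _ _

/-- The overlap `|⟨u_i|v_j⟩|²` of two basis vectors. -/
noncomputable def overlap (u v : OrthonormalBasis n ℂ (EuclideanSpace ℂ n)) (i j : n) : ℝ :=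
  (basisProj u i * basisProj v j).trace.re

theorem ofReal_overlap (u v : OrthonormalBasis n ℂ (EuclideanSpace ℂ n)) (i j : n) :
    (overlap u v i j : ℂ) = (basisProj u i * basisProj v j).trace := by
  rw [overlap, trace_basisProj_mul_basisProj, Complex.ofReal_re]

theorem overlap_nonneg (u v : OrthonormalBasis n ℂ (EuclideanSpace ℂ n)) (i j : n) :
    0 ≤ overlap u v i j := by
  rw [overlap, trace_basisProj_mul_basisProj, Complex.ofReal_re]
  exact Complex.normSq_nonneg _

variable [DecidableEq n]

theorem sum_overlap_right (u v : OrthonormalBasis n ℂ (EuclideanSpace ℂ n)) (i : n) :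
    ∑ j, overlap u v i j = 1 := by
  simp only [overlap]
  rw [← Complex.re_sum, ← trace_sum, ← Finset.mul_sum, (isPVM_basisProj v).sum_eq, mul_one,
    trace_basisProj, Complex.one_re]

theorem sum_overlap_left (u v : OrthonormalBasis n ℂ (EuclideanSpace ℂ n)) (j : n) :
    ∑ i, overlap u v i j = 1 := by
  simp only [overlap]
  rw [← Complex.re_sum, ← trace_sum, ← Finset.sum_mul, (isPVM_basisProj u).sum_eq, one_mul,
    trace_basisProj, Complex.one_re]

theorem overlap_le_one (u v : OrthonormalBasis n ℂ (EuclideanSpace ℂ n)) (i j : n) :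
    overlap u v i j ≤ 1 := by
  rw [← sum_overlap_right u v i]
  exact Finset.single_le_sum (fun k _ => overlap_nonneg u v i k) (Finset.mem_univ j)

theorem overlap_self (u : OrthonormalBasis n ℂ (EuclideanSpace ℂ n)) (i j : n) :
    overlap u u i j = if i = j then 1 else 0 := by
  rw [overlap, (isPVM_basisProj u).mul_eq]
  split_ifs <;> simp [trace_basisProj]

end Overlap

/-! ### Partial traces of sums and of tensor products -/

section PartialTrace

variable {m n : Type*}

theorem traceBob_sum [Fintype n] {ι : Type*} (s : Finset ι) (f : ι → Matrix (m × n) (m × n) ℂ) :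
    traceBob (∑ x ∈ s, f x) = ∑ x ∈ s, traceBob (f x) := by
  ext i j
  simp only [traceBob, of_apply, Matrix.sum_apply]
  exact Finset.sum_comm

theorem traceAlice_sum [Fintype m] {ι : Type*} (s : Finset ι) (f : ι → Matrix (m × n) (m × n) ℂ) :
    traceAlice (∑ x ∈ s, f x) = ∑ x ∈ s, traceAlice (f x) := by
  ext i j
  simp only [traceAlice, of_apply, Matrix.sum_apply]
  exact Finset.sum_comm

theorem traceBob_smul_kronecker [Fintype n] (c : ℝ) (A : Matrix m m ℂ) (B : Matrix n n ℂ) :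
    traceBob (c • (A ⊗ₖ B)) = (c * B.trace) • A := by
  ext i j
  simp only [traceBob, of_apply, Matrix.smul_apply, kroneckerMap_apply, trace, diag_apply,
    Complex.real_smul, smul_eq_mul, Finset.mul_sum, Finset.sum_mul]
  exact Finset.sum_congr rfl fun k _ => by ring

theorem traceAlice_smul_kronecker [Fintype m] (c : ℝ) (A : Matrix m m ℂ) (B : Matrix n n ℂ) :
    traceAlice (c • (A ⊗ₖ B)) = (c * A.trace) • B := by
  ext i j
  simp only [traceAlice, of_apply, Matrix.smul_apply, kroneckerMap_apply, trace, diag_apply,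
    Complex.real_smul, smul_eq_mul, Finset.mul_sum, Finset.sum_mul]
  exact Finset.sum_congr rfl fun k _ => by ring

end PartialTrace

/-! ### The Werner state, its reduced states and its entropy -/

section Werner

variable {d : ℕ} {t : ℝ}

/-- The coefficient of the identity in the Werner state. -/
noncomputable def oneCoeff (d : ℕ) (t : ℝ) : ℝ := (d - 1 + 2 * t) / (d * (d ^ 2 - 1))

/-- The coefficient of the flip operator in the Werner state. -/
noncomputable def flipCoeff (d : ℕ) (t : ℝ) : ℝ := 2 * (1 - t) / (d * (d + 1)) - oneCoeff d t

theorem one_lt_cast (hd : 2 ≤ d) : (1 : ℝ) < d := by exact_mod_cast hd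

theorem oneCoeff_add_flipCoeff (d : ℕ) (t : ℝ) :
    oneCoeff d t + flipCoeff d t = 2 * (1 - t) / (d * (d + 1)) := by
  rw [flipCoeff]; ring

theorem oneCoeff_sub_flipCoeff (hd : 2 ≤ d) (t : ℝ) :
    oneCoeff d t - flipCoeff d t = 2 * t / (d * (d - 1)) := by
  have h := one_lt_cast hd
  have h1 : (d : ℝ) - 1 ≠ 0 := by linarith
  have h2 : (d : ℝ) + 1 ≠ 0 := by linarith
  have h3 : (d : ℝ) ≠ 0 := by linarith
  have h4 : (d : ℝ) ^ 2 - 1 = (d - 1) * (d + 1) := by ring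
  rw [flipCoeff, oneCoeff, h4]
  field_simp
  ring

/-- This is the unit trace condition, because the identity has trace `d ^ 2` and the flip has trace
`d`. -/
theorem oneCoeff_flipCoeff_normalized (hd : 2 ≤ d) (t : ℝ) :
    d * (oneCoeff d t * d + flipCoeff d t) = 1 := by
  have h := one_lt_cast hd
  have h1 : (d : ℝ) - 1 ≠ 0 := by linarith
  have h2 : (d : ℝ) + 1 ≠ 0 := by linarith
  have h3 : (d : ℝ) ≠ 0 := by linarith
  have h4 : (d : ℝ) ^ 2 - 1 = (d - 1) * (d + 1) := by ring
  rw [flipCoeff, oneCoeff, h4]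
  field_simp
  ring

theorem oneCoeff_pos (hd : 2 ≤ d) (ht0 : 0 ≤ t) : 0 < oneCoeff d t := by
  have h := one_lt_cast hd
  have h4 : (d : ℝ) ^ 2 - 1 = (d - 1) * (d + 1) := by ring
  rw [oneCoeff, h4]
  have h1 : (0 : ℝ) < d - 1 := by linarith
  positivity

theorem oneCoeff_add_flipCoeff_nonneg (ht1 : t ≤ 1) : 0 ≤ oneCoeff d t + flipCoeff d t := by
  rw [oneCoeff_add_flipCoeff]
  have : 0 ≤ 1 - t := by linarith
  positivity

theorem wernerState_eq (hd : 2 ≤ d) (t : ℝ) :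
    wernerState d t = oneCoeff d t • 1 + flipCoeff d t • flip d := by
  rw [wernerState, ← oneCoeff_add_flipCoeff, ← oneCoeff_sub_flipCoeff hd, symProj, antisymProj]
  module

theorem flip_mul (M : Matrix (Fin d × Fin d) (Fin d × Fin d) ℂ) (x y : Fin d × Fin d) :
    (flip d * M) x y = M x.swap y := by
  rw [mul_apply, Finset.sum_eq_single x.swap]
  · simp [flip]
  · intro z _ hz
    have : x ≠ z.swap := fun h => hz (by rw [h, Prod.swap_swap])
    simp [flip, this]
  · simp

theorem flip_mul_flip : flip d * flip d = 1 := by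
  ext x y
  rw [flip_mul, one_apply]
  simp [flip, Prod.swap_inj]

theorem flip_isHermitian : (flip d).IsHermitian := by
  ext x y
  have : y = x.swap ↔ x = y.swap := by
    constructor <;> (rintro rfl; simp)
  simp [flip, conjTranspose_apply, this]

theorem trace_flip : (flip d).trace = d := by
  have h : ∀ x : Fin d × Fin d, x = x.swap ↔ x.1 = x.2 := fun x => by
    rw [Prod.ext_iff]
    simp only [Prod.fst_swap, Prod.snd_swap]
    constructor
    · exact fun h => h.1
    · exact fun h => ⟨h, h.symm⟩
  simp only [trace, diag_apply, flip, of_apply, h, Fintype.sum_prod_type]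
  simp

/-- The swap trick: it turns the flip part of a product expectation into an overlap. -/
theorem trace_flip_mul_kronecker (A B : Matrix (Fin d) (Fin d) ℂ) :
    (flip d * (A ⊗ₖ B)).trace = (A * B).trace := by
  simp only [trace, diag_apply, flip_mul]
  simp only [mul_apply, Fintype.sum_prod_type, kroneckerMap_apply, Prod.fst_swap, Prod.snd_swap]
  rw [Finset.sum_comm]

theorem flip_mul_basisProj_kronecker_self (u : OrthonormalBasis (Fin d) ℂ
    (EuclideanSpace ℂ (Fin d))) (k : Fin d) :
    flip d * (basisProj u k ⊗ₖ basisProj u k) = basisProj u k ⊗ₖ basisProj u k := by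
  ext x y
  rw [flip_mul]
  simp only [kroneckerMap_apply, basisProj, of_apply, Prod.fst_swap, Prod.snd_swap]
  ring

theorem trace_wernerState_mul_kronecker (hd : 2 ≤ d) (t : ℝ) (A B : Matrix (Fin d) (Fin d) ℂ) :
    (wernerState d t * (A ⊗ₖ B)).trace =
      oneCoeff d t * (A.trace * B.trace) + flipCoeff d t * (A * B).trace := by
  rw [wernerState_eq hd, add_mul, smul_mul_assoc, smul_mul_assoc, one_mul, trace_add, trace_smul,
    trace_smul, trace_kronecker, trace_flip_mul_kronecker]
  simp

theorem trace_wernerState_mul_basisProj (hd : 2 ≤ d) (t : ℝ)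
    (u v : OrthonormalBasis (Fin d) ℂ (EuclideanSpace ℂ (Fin d))) (i j : Fin d) :
    (wernerState d t * (basisProj u i ⊗ₖ basisProj v j)).trace =
      ((oneCoeff d t + flipCoeff d t * overlap u v i j : ℝ) : ℂ) := by
  rw [trace_wernerState_mul_kronecker hd, trace_basisProj, trace_basisProj, ← ofReal_overlap]
  push_cast
  ring

/-- Tracing out Bob against the flip transports `E` unchanged to Alice's side, while the identity
part only contributes `tr E`. -/
theorem traceBob_kronecker_mul_wernerState (hd : 2 ≤ d) (t : ℝ) (E : Matrix (Fin d) (Fin d) ℂ) :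
    traceBob (((1 : Matrix (Fin d) (Fin d) ℂ) ⊗ₖ E) * wernerState d t) =
      (oneCoeff d t * E.trace) • 1 + (flipCoeff d t : ℂ) • E := by
  have hflip : ∀ (M : Matrix (Fin d × Fin d) (Fin d × Fin d) ℂ) (x y : Fin d × Fin d),
      (M * flip d) x y = M x y.swap := fun M x y => by
    rw [mul_apply, Finset.sum_eq_single y.swap]
    · simp [flip]
    · intro z _ hz
      simp [flip, hz]
    · simp
  rw [wernerState_eq hd, mul_add, mul_smul_comm, mul_smul_comm, mul_one]
  ext i j
  simp only [traceBob, of_apply, Matrix.add_apply, Matrix.smul_apply, hflip, kroneckerMap_apply,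
    Prod.swap_prod_mk, Finset.sum_add_distrib, Complex.real_smul, smul_eq_mul, one_apply, trace,
    diag_apply, Finset.mul_sum, Finset.sum_mul]
  simp [mul_comm, mul_left_comm]

theorem traceAlice_wernerState (hd : 2 ≤ d) (t : ℝ) :
    traceAlice (wernerState d t) = (1 / d : ℝ) • 1 := by
  have h := oneCoeff_flipCoeff_normalized hd t
  have hd0 : (d : ℝ) ≠ 0 := by have := one_lt_cast hd; linarith
  have h' : (1 / d : ℝ) = oneCoeff d t * d + flipCoeff d t := by
    rw [div_eq_iff hd0, ← h, mul_comm]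
  rw [wernerState_eq hd, h']
  ext i j
  simp only [traceAlice, of_apply, Matrix.add_apply, Matrix.smul_apply, flip, Prod.swap_prod_mk,
    Finset.sum_add_distrib, Complex.real_smul, one_apply, Prod.mk.injEq]
  by_cases hij : i = j
  · subst hij
    have : ∀ k : Fin d, (k = i ∧ i = k) ↔ k = i := fun k => ⟨fun h => h.1, fun h => ⟨h, h.symm⟩⟩
    simp [mul_comm, this]
  · have : ∀ k : Fin d, ¬ (k = j ∧ i = k) := fun k hk => hij (hk.2.trans hk.1)
    simp [hij, this]

theorem traceBob_wernerState (hd : 2 ≤ d) (t : ℝ) :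
    traceBob (wernerState d t) = (1 / d : ℝ) • 1 := by
  have h := traceBob_kronecker_mul_wernerState hd t 1
  have h1 := oneCoeff_flipCoeff_normalized hd t
  have hd0 : (d : ℝ) ≠ 0 := by have := one_lt_cast hd; linarith
  have h' : (1 / d : ℝ) = oneCoeff d t * d + flipCoeff d t := by
    rw [div_eq_iff hd0, ← h1, mul_comm]
  rw [one_kronecker_one, one_mul] at h
  rw [h, h', ← add_smul, trace_one, Fintype.card_fin]
  ext i j
  simp

theorem isPVM_symProj_antisymProj (d : ℕ) :
    IsPVM fun b : Bool => if b then symProj d else antisymProj d where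
  isHermitian b := by
    cases b <;> simp [symProj, antisymProj, IsHermitian, conjTranspose_smul, flip_isHermitian.eq]
  mul_eq b c := by
    have h := flip_mul_flip (d := d)
    cases b <;> cases c <;>
      simp only [symProj, antisymProj, smul_mul_assoc, mul_smul_comm, mul_add, add_mul, mul_sub,
        sub_mul, mul_one, one_mul, h, if_true, if_false, reduceCtorEq, Bool.false_eq_true] <;>
      module
  sum_eq := by
    simp only [Fintype.sum_bool, symProj, antisymProj, if_true, Bool.false_eq_true, if_false]
    module

theorem wernerState_eq_sum (d : ℕ) (t : ℝ) :
    wernerState d t = ∑ b : Bool, (if b then 2 * (1 - t) / (d * (d + 1)) else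
      2 * t / (d * (d - 1)) : ℝ) • (if b then symProj d else antisymProj d) := by
  simp [wernerState]

theorem trace_symProj (d : ℕ) : (symProj d).trace = ((d * (d + 1) / 2 : ℝ) : ℂ) := by
  rw [symProj, trace_smul, trace_add, trace_one, trace_flip]
  simp
  ring

theorem trace_antisymProj (d : ℕ) : (antisymProj d).trace = ((d * (d - 1) / 2 : ℝ) : ℂ) := by
  rw [antisymProj, trace_smul, trace_sub, trace_one, trace_flip]
  simp
  ring

theorem isDensity_wernerState (hd : 2 ≤ d) (ht0 : 0 ≤ t) (ht1 : t ≤ 1) :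
    IsDensity (wernerState d t) := by
  have h := one_lt_cast hd
  have h1 : (0 : ℝ) < d - 1 := by linarith
  have h2 : (0 : ℝ) ≤ 1 - t := by linarith
  constructor
  · have hs := (isPVM_symProj_antisymProj d).posSemidef true
    have ha := (isPVM_symProj_antisymProj d).posSemidef false
    simp only [if_true, Bool.false_eq_true, if_false] at hs ha
    exact (hs.smul (by positivity)).add (ha.smul (by positivity))
  · rw [wernerState, trace_add, trace_smul, trace_smul, trace_symProj, trace_antisymProj,
      Complex.real_smul, Complex.real_smul]
    rw [← Complex.ofReal_mul, ← Complex.ofReal_mul, ← Complex.ofReal_add, ← Complex.ofReal_one]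
    congr 1
    field_simp
    ring

theorem entropy_wernerState (hd : 2 ≤ d) (t : ℝ) :
    entropy (wernerState d t) =
      -((1 - t) * Real.logb 2 (2 * (1 - t) / (d * (d + 1)))) -
        t * Real.logb 2 (2 * t / (d * (d - 1))) := by
  have h := one_lt_cast hd
  have h1 : (d : ℝ) - 1 ≠ 0 := by linarith
  rw [wernerState_eq_sum, (isPVM_symProj_antisymProj d).entropy_sum_smul]
  simp only [Fintype.sum_bool, if_true, Bool.false_eq_true, if_false, trace_symProj,
    trace_antisymProj, Complex.ofReal_re, entropyTerm]
  field_simp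
  ring

theorem entropy_maximallyMixed (hd : 2 ≤ d) :
    entropy ((1 / d : ℝ) • (1 : Matrix (Fin d) (Fin d) ℂ)) = Real.logb 2 d := by
  have h := one_lt_cast hd
  have hP := isPVM_basisProj (EuclideanSpace.basisFun (Fin d) ℂ)
  rw [← hP.sum_eq, Finset.smul_sum, hP.entropy_sum_smul (fun _ => (1 / d : ℝ))]
  simp only [trace_basisProj, entropyTerm, one_div, Real.logb_inv, Complex.one_re]
  simp
  field_simp

theorem mutualInfo_wernerState (hd : 2 ≤ d) (t : ℝ) :
    mutualInfo (wernerState d t) = 2 * Real.logb 2 d - entropy (wernerState d t) := by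
  rw [mutualInfo, traceBob_wernerState hd, traceAlice_wernerState hd, entropy_maximallyMixed hd]
  ring

end Werner

/-! ### Equality case of the chord bound, and scaling -/

theorem sum_entropyTerm_eq {ι : Type*} [Fintype ι] (x y : ℝ) {w : ι → ℝ}
    (hw : ∀ i, w i = 0 ∨ w i = 1) :
    ∑ i, entropyTerm (x + y * w i) =
      (∑ i, w i) * entropyTerm (x + y) + (Fintype.card ι - ∑ i, w i) * entropyTerm x := by
  have h : ∀ i, entropyTerm (x + y * w i) =
      w i * entropyTerm (x + y) + (1 - w i) * entropyTerm x := fun i => by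
    rcases hw i with h | h <;> simp [h]
  simp only [h]
  rw [Finset.sum_add_distrib, ← Finset.sum_mul, ← Finset.sum_mul, Finset.sum_sub_distrib]
  simp

theorem entropyTerm_mul {c : ℝ} (hc : c ≠ 0) (x : ℝ) :
    entropyTerm (c * x) = c * entropyTerm x - c * x * Real.logb 2 c := by
  rcases eq_or_ne x 0 with rfl | hx
  · simp [entropyTerm]
  · rw [entropyTerm, entropyTerm, Real.logb_mul hc hx]
    ring

/-! ### Measurements on Bob's side and the discord -/

section ConditionalEntropy

variable {d : ℕ} {t : ℝ}

/-- The conditional entropy of the Werner state for rank-one measurements of Bob. -/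
noncomputable def minCondEntropy (d : ℕ) (t : ℝ) : ℝ :=
  entropyTerm (d * oneCoeff d t + d * flipCoeff d t) + (d - 1) * entropyTerm (d * oneCoeff d t)

/-- The entropy of the Werner state dephased in a common basis. -/
noncomputable def dephasedEntropy (d : ℕ) (t : ℝ) : ℝ :=
  d * entropyTerm (oneCoeff d t + flipCoeff d t) + (d ^ 2 - d) * entropyTerm (oneCoeff d t)

theorem minCondEntropy_eq (hd : 2 ≤ d) (t : ℝ) :
    minCondEntropy d t = -(2 * (1 - t) / (d + 1)) * Real.logb 2 (2 * (1 - t) / (d + 1))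
      - (d - 1 + 2 * t) / (d + 1) * Real.logb 2 ((d - 1 + 2 * t) / (d ^ 2 - 1)) := by
  have h := one_lt_cast hd
  have h0 : (d : ℝ) ≠ 0 := by linarith
  have h1 : (d : ℝ) - 1 ≠ 0 := by linarith
  have h2 : (d : ℝ) + 1 ≠ 0 := by linarith
  have h4 : (d : ℝ) ^ 2 - 1 = (d - 1) * (d + 1) := by ring
  have e1 : d * oneCoeff d t + d * flipCoeff d t = 2 * (1 - t) / (d + 1) := by
    rw [← mul_add, oneCoeff_add_flipCoeff]
    field_simp
  have e2 : d * oneCoeff d t = (d - 1 + 2 * t) / (d ^ 2 - 1) := by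
    rw [oneCoeff, h4]
    field_simp
  have e3 : (d - 1 + 2 * t) / (d + 1) = (d - 1) * ((d - 1 + 2 * t) / (d ^ 2 - 1)) := by
    rw [h4]
    field_simp
  rw [minCondEntropy, e1, e2, e3, entropyTerm, entropyTerm]
  ring

/-- The chain rule for entropy: Bob's outcome is uniform on `d` values, contributing `log d`.
Formally it is the scaling law for `entropyTerm` together with the normalization of the
coefficients. -/
theorem dephasedEntropy_eq (hd : 2 ≤ d) (t : ℝ) :
    dephasedEntropy d t = Real.logb 2 d + minCondEntropy d t := by
  have h := one_lt_cast hd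
  have h0 : (d : ℝ) ≠ 0 := by linarith
  have hn := oneCoeff_flipCoeff_normalized hd t
  rw [dephasedEntropy, minCondEntropy, ← mul_add, entropyTerm_mul h0, entropyTerm_mul h0]
  linear_combination Real.logb 2 d * hn

theorem outcomeProb_wernerState (hd : 2 ≤ d) (t : ℝ) (E : Matrix (Fin d) (Fin d) ℂ) :
    outcomeProb (wernerState d t) E = E.trace.re / d := by
  have h := one_lt_cast hd
  have h0 : (d : ℝ) ≠ 0 := by linarith
  have hn := oneCoeff_flipCoeff_normalized hd t
  rw [outcomeProb, trace_mul_comm, trace_wernerState_mul_kronecker hd, one_mul, trace_one,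
    Fintype.card_fin]
  simp only [Complex.add_re, Complex.re_ofReal_mul, ← Complex.ofReal_natCast]
  rw [eq_div_iff h0]
  linear_combination E.trace.re * hn

theorem trace_eq_ofReal_re {E : Matrix (Fin d) (Fin d) ℂ} (hE : E.IsHermitian) :
    E.trace = (E.trace.re : ℂ) := by
  rw [hE.trace_eq_sum_eigenvalues, ← RCLike.ofReal_sum]
  simp

theorem sum_eigenvalues_div_trace {E : Matrix (Fin d) (Fin d) ℂ} (hE : E.IsHermitian)
    (h0 : E.trace.re ≠ 0) : ∑ k, hE.eigenvalues k / E.trace.re = 1 := by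
  rw [← Finset.sum_div, div_eq_one_iff_eq h0, hE.trace_eq_sum_eigenvalues, ← RCLike.ofReal_sum]
  simp

theorem condState_wernerState (hd : 2 ≤ d) (t : ℝ) {E : Matrix (Fin d) (Fin d) ℂ}
    (hE : E.IsHermitian) (h0 : E.trace.re ≠ 0) :
    condState (wernerState d t) E =
      (d * oneCoeff d t : ℝ) • 1 + (d * flipCoeff d t / E.trace.re : ℝ) • E := by
  have h := one_lt_cast hd
  have hd0 : (d : ℝ) ≠ 0 := by linarith
  have e1 : (oneCoeff d t * E.trace) • (1 : Matrix (Fin d) (Fin d) ℂ) =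
      (oneCoeff d t * E.trace.re : ℝ) • 1 := by
    rw [trace_eq_ofReal_re hE, Complex.ofReal_re, ← Complex.ofReal_mul, Complex.coe_smul]
  rw [condState, outcomeProb_wernerState hd, traceBob_kronecker_mul_wernerState hd, e1,
    Complex.coe_smul, smul_add, smul_smul, smul_smul]
  congr 2 <;> field_simp

/-- The conditional state is an affine function of `E`, so an eigenbasis of `E` diagonalizes it. -/
theorem entropy_condState_wernerState (hd : 2 ≤ d) (t : ℝ) {E : Matrix (Fin d) (Fin d) ℂ}
    (hE : E.IsHermitian) (h0 : E.trace.re ≠ 0) :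
    entropy (condState (wernerState d t) E) =
      ∑ k, entropyTerm (d * oneCoeff d t +
        d * flipCoeff d t * (hE.eigenvalues k / E.trace.re)) := by
  have hP := isPVM_basisProj hE.eigenvectorBasis
  have h : condState (wernerState d t) E = ∑ k, (d * oneCoeff d t +
      d * flipCoeff d t * (hE.eigenvalues k / E.trace.re)) • basisProj hE.eigenvectorBasis k := by
    rw [condState_wernerState hd t hE h0]
    conv_lhs => rw [← hP.sum_eq]
    conv_lhs => enter [2, 2]; rw [isHermitian_eq_sum_smul_basisProj hE]
    rw [Finset.smul_sum, Finset.smul_sum, ← Finset.sum_add_distrib]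
    refine Finset.sum_congr rfl fun k _ => ?_
    rw [smul_smul, ← add_smul]
    congr 1
    ring
  rw [h, hP.entropy_sum_smul]
  simp [trace_basisProj]

theorem trace_re_nonneg {E : Matrix (Fin d) (Fin d) ℂ} (hE : E.PosSemidef) :
    0 ≤ E.trace.re :=
  (Complex.le_def.mp hE.trace_nonneg).1

/-- The eigenvalues of `E` divided by its trace form a probability distribution, so the chord bound
applies with total weight one. -/
theorem minCondEntropy_le_entropy_condState (hd : 2 ≤ d) (ht0 : 0 ≤ t) (ht1 : t ≤ 1)
    {E : Matrix (Fin d) (Fin d) ℂ} (hE : E.PosSemidef) (h0 : E.trace.re ≠ 0) :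
    minCondEntropy d t ≤ entropy (condState (wernerState d t) E) := by
  have hpos : 0 < E.trace.re := lt_of_le_of_ne (trace_re_nonneg hE) h0.symm
  have hw0 : ∀ k, 0 ≤ hE.isHermitian.eigenvalues k / E.trace.re := fun k =>
    div_nonneg (hE.eigenvalues_nonneg k) hpos.le
  have hsum := sum_eigenvalues_div_trace hE.isHermitian h0
  have hw1 : ∀ k, hE.isHermitian.eigenvalues k / E.trace.re ≤ 1 := fun k => by
    rw [← hsum]
    exact Finset.single_le_sum (fun l _ => hw0 l) (Finset.mem_univ k)
  have hx : 0 ≤ d * oneCoeff d t := mul_nonneg d.cast_nonneg (oneCoeff_pos hd ht0).le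
  have hxy : 0 ≤ d * oneCoeff d t + d * flipCoeff d t := by
    rw [← mul_add]
    exact mul_nonneg d.cast_nonneg (oneCoeff_add_flipCoeff_nonneg ht1)
  have h := sum_entropyTerm_ge hx hxy hw0 hw1
  rw [hsum, one_mul, Fintype.card_fin] at h
  rw [entropy_condState_wernerState hd t hE.isHermitian h0]
  exact h

theorem trace_re_ne_zero {E : Matrix (Fin d) (Fin d) ℂ} (hE : E.PosSemidef) (hr : E ≠ 0) :
    E.trace.re ≠ 0 := fun h => hr <| hE.trace_eq_zero_iff.mp <| by
  rw [trace_eq_ofReal_re hE.isHermitian, h, Complex.ofReal_zero]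

/-- Rank one leaves a single nonzero eigenvalue, equal to the trace, so the normalized weights are
all 0 or 1 and the chord bound is tight. -/
theorem entropy_condState_of_rank_eq_one (hd : 2 ≤ d) (t : ℝ)
    {E : Matrix (Fin d) (Fin d) ℂ} (hE : E.PosSemidef) (hr : E.rank = 1) :
    entropy (condState (wernerState d t) E) = minCondEntropy d t := by
  have h0 : E.trace.re ≠ 0 := trace_re_ne_zero hE fun h => by simp [h] at hr
  have hsum := sum_eigenvalues_div_trace hE.isHermitian h0
  rw [hE.isHermitian.rank_eq_card_non_zero_eigs, Fintype.card_eq_one_iff] at hr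
  obtain ⟨⟨k, hk⟩, huniq⟩ := hr
  have hz : ∀ l, l ≠ k → hE.isHermitian.eigenvalues l = 0 := fun l hl => by
    by_contra h
    exact hl (congrArg Subtype.val (huniq ⟨l, h⟩))
  have hw : ∀ l, hE.isHermitian.eigenvalues l / E.trace.re = 0 ∨
      hE.isHermitian.eigenvalues l / E.trace.re = 1 := fun l => by
    rcases eq_or_ne l k with rfl | hl
    · right
      rw [← hsum, Finset.sum_eq_single l (fun m _ hm => by rw [hz m hm, zero_div]) (by simp)]
    · left
      rw [hz l hl, zero_div]
  rw [entropy_condState_wernerState hd t hE.isHermitian h0, sum_entropyTerm_eq _ _ hw, hsum,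
    one_mul, Fintype.card_fin, minCondEntropy]

theorem sum_outcomeProb_wernerState (hd : 2 ≤ d) (t : ℝ) {N : ℕ}
    {E : Fin N → Matrix (Fin d) (Fin d) ℂ} (hE : IsPOVM E) :
    ∑ k, outcomeProb (wernerState d t) (E k) = 1 := by
  have h := one_lt_cast hd
  have hd0 : (d : ℝ) ≠ 0 := by linarith
  simp only [outcomeProb_wernerState hd]
  rw [← Finset.sum_div, ← Complex.re_sum, ← trace_sum, hE.2, trace_one, Fintype.card_fin,
    Complex.natCast_re, div_self hd0]

theorem minCondEntropy_le_condEntropy (hd : 2 ≤ d) (ht0 : 0 ≤ t) (ht1 : t ≤ 1) {N : ℕ}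
    {E : Fin N → Matrix (Fin d) (Fin d) ℂ} (hE : IsPOVM E) :
    minCondEntropy d t ≤ condEntropy (wernerState d t) E := by
  rw [condEntropy, ← one_mul (minCondEntropy d t), ← sum_outcomeProb_wernerState hd t hE,
    Finset.sum_mul]
  refine Finset.sum_le_sum fun k _ => ?_
  rw [outcomeProb_wernerState hd]
  rcases eq_or_ne (E k).trace.re 0 with h0 | h0
  · simp [h0]
  · exact mul_le_mul_of_nonneg_left
      (minCondEntropy_le_entropy_condState hd ht0 ht1 (hE.1 k) h0)
      (div_nonneg (trace_re_nonneg (hE.1 k)) d.cast_nonneg)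

theorem condEntropy_of_isRankOnePOVM (hd : 2 ≤ d) (t : ℝ) {N : ℕ}
    {E : Fin N → Matrix (Fin d) (Fin d) ℂ} (hE : IsRankOnePOVM E) :
    condEntropy (wernerState d t) E = minCondEntropy d t := by
  rw [condEntropy]
  simp only [entropy_condState_of_rank_eq_one hd t (hE.1.1 _) (hE.2 _)]
  rw [← Finset.sum_mul, sum_outcomeProb_wernerState hd t hE.1, one_mul]

theorem isRankOnePOVM_basisProj (u : OrthonormalBasis (Fin d) ℂ (EuclideanSpace ℂ (Fin d))) :
    IsRankOnePOVM (basisProj u) :=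
  ⟨⟨(isPVM_basisProj u).posSemidef, (isPVM_basisProj u).sum_eq⟩, rank_basisProj u⟩

theorem isDiagonalIn_smul_one (u : OrthonormalBasis (Fin d) ℂ (EuclideanSpace ℂ (Fin d)))
    (c : ℝ) : IsDiagonalIn u (c • 1) := by
  refine ⟨fun _ => c, ?_⟩
  rw [← (isPVM_basisProj u).sum_eq, Finset.smul_sum]
  simp only [Complex.coe_smul]

theorem isDiagonalIn_condState_wernerState (hd : 2 ≤ d) (t : ℝ)
    (u : OrthonormalBasis (Fin d) ℂ (EuclideanSpace ℂ (Fin d))) (k : Fin d) :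
    IsDiagonalIn u (condState (wernerState d t) (basisProj u k)) := by
  rw [condState_wernerState hd t ((isPVM_basisProj u).isHermitian k)
    (by simp [trace_basisProj])]
  obtain ⟨c, hc⟩ := isDiagonalIn_smul_one u (d * oneCoeff d t)
  rw [hc]
  generalize d * flipCoeff d t / (basisProj u k).trace.re = y
  refine ⟨fun l => c l + if l = k then (y : ℂ) else 0, ?_⟩
  simp [add_smul, Finset.sum_add_distrib]

theorem isGreatest_classicalCorrelationValues (hd : 2 ≤ d) (ht0 : 0 ≤ t) (ht1 : t ≤ 1) :
    IsGreatest (classicalCorrelationValues (wernerState d t))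
      (Real.logb 2 d - minCondEntropy d t) := by
  have hA : entropy (traceBob (wernerState d t)) = Real.logb 2 d := by
    rw [traceBob_wernerState hd, entropy_maximallyMixed hd]
  constructor
  · have hE := isRankOnePOVM_basisProj (EuclideanSpace.basisFun (Fin d) ℂ)
    exact ⟨d, _, hE.1, by rw [hA, condEntropy_of_isRankOnePOVM hd t hE]⟩
  · rintro _ ⟨N, E, hE, rfl⟩
    rw [hA]
    exact sub_le_sub_left (minCondEntropy_le_condEntropy hd ht0 ht1 hE) _

theorem discord_wernerState (hd : 2 ≤ d) (ht0 : 0 ≤ t) (ht1 : t ≤ 1) :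
    discord (wernerState d t) = dephasedEntropy d t - entropy (wernerState d t) := by
  rw [discord, classicalCorrelations,
    (isGreatest_classicalCorrelationValues hd ht0 ht1).csSup_eq, mutualInfo_wernerState hd,
    dephasedEntropy_eq hd]
  ring

theorem discord_wernerState_closed_form (hd : 2 ≤ d) (ht0 : 0 ≤ t) (ht1 : t ≤ 1) :
    discord (wernerState d t) =
      Real.logb 2 (d + 1) + t * Real.logb 2 (t / (d - 1))
        + (1 - t) * Real.logb 2 ((1 - t) / (d + 1))
        - 2 * (1 - t) / (d + 1) * Real.logb 2 (1 - t)
        - (d - 1 + 2 * t) / (d + 1) * Real.logb 2 ((d - 1 + 2 * t) / (2 * (d - 1))) := by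
  have h := one_lt_cast hd
  have h0 : (d : ℝ) ≠ 0 := by linarith
  have h1 : (d : ℝ) - 1 ≠ 0 := by linarith
  have h2 : (d : ℝ) + 1 ≠ 0 := by linarith
  have h3 : (d : ℝ) - 1 + 2 * t ≠ 0 := by linarith
  have hd1 : (d : ℝ) ^ 2 - 1 = (d - 1) * (d + 1) := by ring
  have htwo : Real.logb 2 2 = 1 := Real.logb_self_eq_one one_lt_two
  -- Splitting the logarithm fails at `s = 0`, but the factor `s` makes both sides vanish there.
  -- This covers the endpoints `t = 0` and `t = 1`.
  have key : ∀ s c : ℝ, c ≠ 0 →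
      s * Real.logb 2 (2 * s / c) = s * (1 + Real.logb 2 s - Real.logb 2 c) := fun s c hc => by
    rcases eq_or_ne s 0 with rfl | hs
    · simp
    · rw [Real.logb_div (mul_ne_zero two_ne_zero hs) hc, Real.logb_mul two_ne_zero hs, htwo]
  have key' : ∀ s c : ℝ, c ≠ 0 →
      s * Real.logb 2 (s / c) = s * (Real.logb 2 s - Real.logb 2 c) := fun s c hc => by
    rcases eq_or_ne s 0 with rfl | hs
    · simp
    · rw [Real.logb_div hs hc]
  have e : -(2 * (1 - t) / ((d : ℝ) + 1)) * Real.logb 2 (2 * (1 - t) / (d + 1)) =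
      -(2 / ((d : ℝ) + 1)) * ((1 - t) * Real.logb 2 (2 * (1 - t) / (d + 1))) := by ring
  rw [discord_wernerState hd ht0 ht1, dephasedEntropy_eq hd, minCondEntropy_eq hd,
    entropy_wernerState hd, e, key _ _ h2, key _ _ (mul_ne_zero h0 h2),
    key _ _ (mul_ne_zero h0 h1), key' _ _ h1, key' _ _ h2, hd1, Real.logb_div h3
    (mul_ne_zero h1 h2), Real.logb_div h3 (mul_ne_zero two_ne_zero h1), Real.logb_mul h0 h2,
    Real.logb_mul h0 h1, Real.logb_mul h1 h2, Real.logb_mul two_ne_zero h1, htwo]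
  field_simp
  ring

end ConditionalEntropy

/-! ### Local dephasing and the measurement-induced disturbance -/

section Dephasing

variable {d : ℕ} {t : ℝ}

theorem dephase_wernerState (hd : 2 ≤ d) (t : ℝ)
    (u v : OrthonormalBasis (Fin d) ℂ (EuclideanSpace ℂ (Fin d))) :
    dephase u v (wernerState d t) =
      ∑ x : Fin d × Fin d, (oneCoeff d t + flipCoeff d t * overlap u v x.1 x.2) •
        (basisProj u x.1 ⊗ₖ basisProj v x.2) := by
  rw [dephase, Fintype.sum_prod_type]
  simp only [basisProj_kronecker_mul_mul, trace_wernerState_mul_basisProj hd, Complex.coe_smul]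

theorem entropy_dephase_wernerState (hd : 2 ≤ d) (t : ℝ)
    (u v : OrthonormalBasis (Fin d) ℂ (EuclideanSpace ℂ (Fin d))) :
    entropy (dephase u v (wernerState d t)) =
      ∑ x : Fin d × Fin d,
        entropyTerm (oneCoeff d t + flipCoeff d t * overlap u v x.1 x.2) := by
  have hP := isPVM_conditional (P := fun _ : Fin d => basisProj u)
    (fun _ => isPVM_basisProj u) (isPVM_basisProj v)
  rw [dephase_wernerState hd, hP.entropy_sum_smul fun x : Fin d × Fin d =>
    oneCoeff d t + flipCoeff d t * overlap u v x.1 x.2]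
  simp [trace_kronecker, trace_basisProj]

theorem sum_coeff_overlap_eq (hd : 2 ≤ d) (t : ℝ) {w : Fin d → ℝ} (hw : ∑ k, w k = 1) :
    ∑ k, (oneCoeff d t + flipCoeff d t * w k) = 1 / d := by
  have h := one_lt_cast hd
  have h0 : (d : ℝ) ≠ 0 := by linarith
  rw [Finset.sum_add_distrib, ← Finset.mul_sum, hw, eq_div_iff h0,
    Finset.sum_const, Finset.card_univ, Fintype.card_fin, nsmul_eq_mul]
  linear_combination oneCoeff_flipCoeff_normalized hd t

theorem traceBob_dephase_wernerState (hd : 2 ≤ d) (t : ℝ)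
    (u v : OrthonormalBasis (Fin d) ℂ (EuclideanSpace ℂ (Fin d))) :
    traceBob (dephase u v (wernerState d t)) = (1 / d : ℝ) • 1 := by
  rw [dephase_wernerState hd, traceBob_sum, Fintype.sum_prod_type, ← (isPVM_basisProj u).sum_eq,
    Finset.smul_sum]
  simp only [traceBob_smul_kronecker, trace_basisProj, mul_one, Complex.coe_smul]
  refine Finset.sum_congr rfl fun i _ => ?_
  rw [← Finset.sum_smul, sum_coeff_overlap_eq hd t (sum_overlap_right u v i)]

theorem traceAlice_dephase_wernerState (hd : 2 ≤ d) (t : ℝ)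
    (u v : OrthonormalBasis (Fin d) ℂ (EuclideanSpace ℂ (Fin d))) :
    traceAlice (dephase u v (wernerState d t)) = (1 / d : ℝ) • 1 := by
  rw [dephase_wernerState hd, traceAlice_sum, Fintype.sum_prod_type_right,
    ← (isPVM_basisProj v).sum_eq, Finset.smul_sum]
  simp only [traceAlice_smul_kronecker, trace_basisProj, mul_one, Complex.coe_smul]
  refine Finset.sum_congr rfl fun j _ => ?_
  rw [← Finset.sum_smul, sum_coeff_overlap_eq hd t (sum_overlap_left u v j)]

/-- The overlaps are doubly stochastic, so dephasing leaves both reduced states maximally mixed; the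
loss of mutual information is exactly the gain of entropy. -/
theorem mutualInfo_sub_mutualInfo_dephase (hd : 2 ≤ d) (t : ℝ)
    (u v : OrthonormalBasis (Fin d) ℂ (EuclideanSpace ℂ (Fin d))) :
    mutualInfo (wernerState d t) - mutualInfo (dephase u v (wernerState d t)) =
      entropy (dephase u v (wernerState d t)) - entropy (wernerState d t) := by
  rw [mutualInfo_wernerState hd, mutualInfo, traceBob_dephase_wernerState hd,
    traceAlice_dephase_wernerState hd, entropy_maximallyMixed hd]
  ring

/-- Weights which add up to `1` for each fixed second index spread the dephased spectrum at
least as much as dephasing in a common basis does. -/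
theorem dephasedEntropy_le_sum (hd : 2 ≤ d) (ht0 : 0 ≤ t) (ht1 : t ≤ 1)
    {w : Fin d × Fin d → ℝ} (hw0 : ∀ x, 0 ≤ w x) (hw : ∀ j, ∑ i, w (i, j) = 1) :
    dephasedEntropy d t ≤ ∑ x, entropyTerm (oneCoeff d t + flipCoeff d t * w x) := by
  have hw1 : ∀ x, w x ≤ 1 := fun x => by
    rw [← hw x.2]
    exact Finset.single_le_sum (f := fun i => w (i, x.2)) (fun i _ => hw0 _)
      (Finset.mem_univ x.1)
  have hsum : ∑ x, w x = d := by
    rw [Fintype.sum_prod_type_right]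
    simp [hw]
  have h := sum_entropyTerm_ge (oneCoeff_pos hd ht0).le (oneCoeff_add_flipCoeff_nonneg ht1)
    hw0 hw1
  rw [hsum, Fintype.card_prod, Fintype.card_fin, Nat.cast_mul, ← sq] at h
  exact h

theorem sum_entropyTerm_overlap_self (u : OrthonormalBasis (Fin d) ℂ (EuclideanSpace ℂ (Fin d))) :
    ∑ x : Fin d × Fin d, entropyTerm (oneCoeff d t + flipCoeff d t * overlap u u x.1 x.2) =
      dephasedEntropy d t := by
  rw [sum_entropyTerm_eq _ _ fun x : Fin d × Fin d => by rw [overlap_self]; split_ifs <;> simp,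
    Fintype.sum_prod_type]
  simp only [sum_overlap_right]
  simp [dephasedEntropy, sq]

theorem mutualInfo_sub_mutualInfo_dephase_self (hd : 2 ≤ d) (ht0 : 0 ≤ t) (ht1 : t ≤ 1)
    (u : OrthonormalBasis (Fin d) ℂ (EuclideanSpace ℂ (Fin d))) :
    mutualInfo (wernerState d t) - mutualInfo (dephase u u (wernerState d t)) =
      discord (wernerState d t) := by
  rw [mutualInfo_sub_mutualInfo_dephase hd, entropy_dephase_wernerState hd,
    sum_entropyTerm_overlap_self, discord_wernerState hd ht0 ht1]

/-- The reduced states are multiples of the identity, so every pair of bases is admissible. The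
weights are the overlaps, and equal bases attain the bound. -/
theorem isLeast_midValues (hd : 2 ≤ d) (ht0 : 0 ≤ t) (ht1 : t ≤ 1) :
    IsLeast (midValues (wernerState d t)) (discord (wernerState d t)) := by
  constructor
  · refine ⟨EuclideanSpace.basisFun (Fin d) ℂ, EuclideanSpace.basisFun (Fin d) ℂ, ?_, ?_,
      (mutualInfo_sub_mutualInfo_dephase_self hd ht0 ht1 _).symm⟩
    · rw [traceBob_wernerState hd]
      exact isDiagonalIn_smul_one _ _
    · rw [traceAlice_wernerState hd]
      exact isDiagonalIn_smul_one _ _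
  · rintro _ ⟨u, v, -, -, rfl⟩
    rw [mutualInfo_sub_mutualInfo_dephase hd, entropy_dephase_wernerState hd,
      discord_wernerState hd ht0 ht1]
    exact sub_le_sub_right (dephasedEntropy_le_sum hd ht0 ht1
      (w := fun x => overlap u v x.1 x.2) (fun x => overlap_nonneg _ _ _ _)
      fun j => sum_overlap_left u v j) _

end Dephasing

/-! ### Relative entropy to classical states -/

section RelativeEntropy

variable {d : ℕ} {t : ℝ}

theorem fullyClassical_subset_quantumClassical (m n : Type*) [Fintype m] [DecidableEq m]
    [Fintype n] [DecidableEq n] : fullyClassical m n ⊆ quantumClassical m n := by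
  rintro σ ⟨η, p, r, hp, hp1, hr, -, rfl⟩
  exact ⟨η, p, r, hp, hp1, hr, rfl⟩

/-- Quantum-classical states are diagonal in a basis of product vectors. -/
theorem exists_sum_smul_of_mem_quantumClassical {m n : Type*} [Fintype m] [DecidableEq m]
    [Fintype n] [DecidableEq n] {σ : Matrix (m × n) (m × n) ℂ} (hσ : σ ∈ quantumClassical m n) :
    ∃ (e : n → OrthonormalBasis m ℂ (EuclideanSpace ℂ m))
      (η : OrthonormalBasis n ℂ (EuclideanSpace ℂ n)) (q : m × n → ℝ),
      (∀ x, 0 ≤ q x) ∧ ∑ x, q x = 1 ∧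
        σ = ∑ x : m × n, q x • (basisProj (e x.2) x.1 ⊗ₖ basisProj η x.2) := by
  obtain ⟨η, p, r, hp, hp1, hr, rfl⟩ := hσ
  have hh : ∀ i, (r i).IsHermitian := fun i => (hr i).1.isHermitian
  -- Alice's basis for Bob's index `i` diagonalizes `r i`; the joint weight is `p i` times the
  -- eigenvalue.
  refine ⟨fun i => (hh i).eigenvectorBasis, η, fun x => p x.2 * (hh x.2).eigenvalues x.1,
    fun x => mul_nonneg (hp _) ((hr x.2).1.eigenvalues_nonneg _), ?_, ?_⟩
  · have h1 : ∀ i, ∑ j, (hh i).eigenvalues j = 1 := fun i => by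
      have h := (hh i).trace_eq_sum_eigenvalues
      rw [(hr i).2, ← RCLike.ofReal_sum] at h
      have h2 := congrArg Complex.re h
      simpa using h2.symm
    rw [Fintype.sum_prod_type_right, ← hp1]
    simp only [← Finset.mul_sum, h1, mul_one]
  · rw [Fintype.sum_prod_type_right]
    refine Finset.sum_congr rfl fun i _ => ?_
    conv_lhs => rw [isHermitian_eq_sum_smul_basisProj (hh i)]
    ext x y
    simp only [Matrix.sum_apply, Matrix.smul_apply, kroneckerMap_apply, Finset.sum_mul,
      Finset.smul_sum, smul_mul_assoc, smul_smul]

/-- The logarithm of `σ` sees only the diagonal of the Werner state in the eigenbasis of `σ`. Gibbs'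
inequality bounds the cross term by the entropy of that diagonal. As Alice's basis varies with Bob's
index, the overlaps are normalized only over Alice's index, which is all that
`dephasedEntropy_le_sum` requires. -/
theorem discord_le_relativeEntropy (hd : 2 ≤ d) (ht0 : 0 ≤ t) (ht1 : t ≤ 1)
    {σ : Matrix (Fin d × Fin d) (Fin d × Fin d) ℂ}
    (hσ : σ ∈ quantumClassical (Fin d) (Fin d)) :
    (discord (wernerState d t) : EReal) ≤ relativeEntropy (wernerState d t) σ := by
  obtain ⟨e, η, q, hq, hq1, rfl⟩ := exists_sum_smul_of_mem_quantumClassical hσ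
  rw [relativeEntropy]
  split_ifs with hker
  swap
  · exact le_top
  have hP := isPVM_conditional (fun i => isPVM_basisProj (e i)) (isPVM_basisProj η)
  rw [EReal.coe_le_coe_iff, hP.trace_mul_matrixLog q, discord_wernerState hd ht0 ht1]
  have hR : ∀ x : Fin d × Fin d,
      (wernerState d t * (basisProj (e x.2) x.1 ⊗ₖ basisProj η x.2)).trace.re =
        oneCoeff d t + flipCoeff d t * overlap (e x.2) η x.1 x.2 := fun x => by
    rw [trace_wernerState_mul_basisProj hd, Complex.ofReal_re]
  -- If `q x = 0`, the columns of the corresponding projector lie in the kernel of `σ`, hence in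
  -- that of the Werner state; the diagonal entry then vanishes, as Gibbs' inequality demands.
  have hzero : ∀ x, q x = 0 →
      oneCoeff d t + flipCoeff d t * overlap (e x.2) η x.1 x.2 = 0 := fun x hx => by
    have h1 := hP.sum_smul_mul q x
    rw [hx, zero_smul] at h1
    have h2 : wernerState d t * (basisProj (e x.2) x.1 ⊗ₖ basisProj η x.2) = 0 := by
      ext y z
      have h3 := hker ((basisProj (e x.2) x.1 ⊗ₖ basisProj η x.2).col z) (by
        rw [← mulVec_single_one, mulVec_mulVec, h1, zero_mulVec])
      exact congrFun h3 y
    rw [← hR, h2, trace_zero, Complex.zero_re]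
  have hov0 : ∀ x : Fin d × Fin d, 0 ≤ overlap (e x.2) η x.1 x.2 := fun x =>
    overlap_nonneg _ _ _ _
  have hov1 : ∀ j, ∑ i, overlap (e j) η i j = 1 := fun j => sum_overlap_left _ _ _
  have hnn : ∀ x : Fin d × Fin d,
      0 ≤ oneCoeff d t + flipCoeff d t * overlap (e x.2) η x.1 x.2 := fun x => by
    -- With overlap `w`, the entry is the convex combination `w * (a + b) + (1 - w) * a` of two
    -- nonnegative eigenvalues of the dephased state.
    have h1 := mul_nonneg (hov0 x) (oneCoeff_add_flipCoeff_nonneg (d := d) ht1)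
    have h2 := mul_nonneg (sub_nonneg.mpr (overlap_le_one (e x.2) η x.1 x.2))
      (oneCoeff_pos hd ht0).le
    linarith
  have hsum : ∑ x, q x =
      ∑ x : Fin d × Fin d, (oneCoeff d t + flipCoeff d t * overlap (e x.2) η x.1 x.2) := by
    rw [hq1, Fintype.sum_prod_type_right]
    simp only [sum_coeff_overlap_eq hd t (hov1 _)]
    have h := one_lt_cast hd
    have h0 : (d : ℝ) ≠ 0 := by linarith
    simp [h0]
  have h1 := dephasedEntropy_le_sum hd ht0 ht1
    (w := fun x => overlap (e x.2) η x.1 x.2) hov0 hov1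
  have h2 := sum_entropyTerm_le_cross hnn hq hzero hsum
  simp only [hR]
  linarith

theorem dephase_wernerState_mem_fullyClassical (hd : 2 ≤ d) (ht0 : 0 ≤ t) (ht1 : t ≤ 1)
    (u : OrthonormalBasis (Fin d) ℂ (EuclideanSpace ℂ (Fin d))) :
    dephase u u (wernerState d t) ∈ fullyClassical (Fin d) (Fin d) := by
  have h := one_lt_cast hd
  have h0 : (d : ℝ) ≠ 0 := by linarith
  have hP := isPVM_basisProj u
  -- Bob's marginal is uniform, so conditioning on his index multiplies the joint weights by `d`.
  set c : Fin d → Fin d → ℝ := fun i j =>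
    d * (oneCoeff d t + flipCoeff d t * overlap u u j i) with hc
  have hc0 : ∀ i j, 0 ≤ c i j := fun i j => by
    refine mul_nonneg d.cast_nonneg ?_
    rw [overlap_self]
    split_ifs
    · simpa using oneCoeff_add_flipCoeff_nonneg ht1
    · simpa using (oneCoeff_pos hd ht0).le
  refine ⟨u, fun _ => 1 / d, fun i => ∑ j, c i j • basisProj u j, fun _ => by positivity, ?_,
    fun i => ⟨posSemidef_sum _ fun j _ => (hP.posSemidef j).smul (hc0 i j), ?_⟩, fun i j => ?_, ?_⟩
  · simp [h0]
  · have hs : ∑ j, c i j = 1 := by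
      rw [← Finset.mul_sum, sum_coeff_overlap_eq hd t (sum_overlap_left u u i),
        mul_one_div_cancel h0]
    simp only [trace_sum, trace_smul, trace_basisProj]
    rw [← Finset.sum_smul, hs, one_smul]
  · rw [commute_iff_eq, hP.sum_smul_mul_sum_smul, hP.sum_smul_mul_sum_smul]
    simp only [mul_comm]
  · rw [dephase_wernerState hd, Fintype.sum_prod_type_right]
    refine Finset.sum_congr rfl fun i _ => ?_
    ext x y
    simp only [Matrix.sum_apply, Matrix.smul_apply, kroneckerMap_apply, Finset.sum_mul,
      Finset.smul_sum, smul_mul_assoc, smul_smul, hc]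
    refine Finset.sum_congr rfl fun j _ => ?_
    congr 1
    field_simp

theorem dephase_self_wernerState (hd : 2 ≤ d) (t : ℝ)
    (u : OrthonormalBasis (Fin d) ℂ (EuclideanSpace ℂ (Fin d))) :
    dephase u u (wernerState d t) =
      oneCoeff d t • 1 + flipCoeff d t • ∑ i, basisProj u i ⊗ₖ basisProj u i := by
  have hP := isPVM_conditional (P := fun _ : Fin d => basisProj u)
    (fun _ => isPVM_basisProj u) (isPVM_basisProj u)
  rw [dephase_wernerState hd]
  simp only [overlap_self, add_smul, Finset.sum_add_distrib]
  congr 1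
  · rw [← Finset.smul_sum]
    exact congrArg _ hP.sum_eq
  · rw [Fintype.sum_prod_type, Finset.smul_sum]
    refine Finset.sum_congr rfl fun i _ => ?_
    rw [Finset.sum_eq_single i (fun j _ hj => by simp [hj.symm]) (by simp)]
    simp

/-- With `D = ∑ i, |u_i u_i⟩⟨u_i u_i|`, the dephased state is `a • 1 + b • D`, and `flip d * D = D =
D * D` makes the product collapse. As `a > 0` for `t ≥ 0`, the factorization gives the kernel
inclusion even at `t = 1`, where the dephased state is singular. -/
theorem smul_wernerState_eq_mul_dephase (hd : 2 ≤ d) (t : ℝ)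
    (u : OrthonormalBasis (Fin d) ℂ (EuclideanSpace ℂ (Fin d))) :
    oneCoeff d t • wernerState d t =
      (wernerState d t - flipCoeff d t • ∑ i, basisProj u i ⊗ₖ basisProj u i) *
        dephase u u (wernerState d t) := by
  rw [dephase_self_wernerState hd, wernerState_eq hd]
  set D := ∑ i, basisProj u i ⊗ₖ basisProj u i with hD
  have hF : flip d * D = D := by
    rw [hD, Finset.mul_sum]
    simp only [flip_mul_basisProj_kronecker_self]
  have hDD : D * D = D := by
    rw [hD, Finset.sum_mul]
    refine Finset.sum_congr rfl fun i _ => ?_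
    rw [Finset.mul_sum]
    simp only [← mul_kronecker_mul, (isPVM_basisProj u).mul_eq]
    rw [Finset.sum_eq_single i (fun j _ hj => by simp [hj.symm]) (by simp)]
    simp
  simp only [sub_mul, add_mul, mul_add, smul_mul_assoc, mul_smul_comm, one_mul, mul_one, hF, hDD]
  module

/-- The Werner state and its dephased version have the same diagonal in the basis of product
vectors, so the cross term is the entropy of the dephased state. -/
theorem relativeEntropy_wernerState_dephase (hd : 2 ≤ d) (ht0 : 0 ≤ t) (ht1 : t ≤ 1)
    (u : OrthonormalBasis (Fin d) ℂ (EuclideanSpace ℂ (Fin d))) :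
    relativeEntropy (wernerState d t) (dephase u u (wernerState d t)) =
      (discord (wernerState d t) : EReal) := by
  have hP := isPVM_conditional (P := fun _ : Fin d => basisProj u)
    (fun _ => isPVM_basisProj u) (isPVM_basisProj u)
  rw [relativeEntropy, if_pos]
  · rw [EReal.coe_eq_coe_iff, dephase_wernerState hd, hP.trace_mul_matrixLog
      fun x : Fin d × Fin d => oneCoeff d t + flipCoeff d t * overlap u u x.1 x.2,
      discord_wernerState hd ht0 ht1, ← sum_entropyTerm_overlap_self u]
    simp only [trace_wernerState_mul_basisProj hd, Complex.ofReal_re, entropyTerm,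
      Finset.sum_neg_distrib]
    rw [neg_sub_left, add_comm, ← neg_add', add_comm]
    simp only [mul_comm]
  · intro v hv
    have h := congrArg (fun M => M.mulVec v) (smul_wernerState_eq_mul_dephase hd t u)
    simp only [← mulVec_mulVec, hv, mulVec_zero, smul_mulVec] at h
    exact (smul_eq_zero.mp h).resolve_left (oneCoeff_pos hd ht0).ne'

theorem isLeast_relativeEntropy_fullyClassical (hd : 2 ≤ d) (ht0 : 0 ≤ t) (ht1 : t ≤ 1) :
    IsLeast (relativeEntropy (wernerState d t) '' fullyClassical (Fin d) (Fin d))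
      (discord (wernerState d t) : EReal) := by
  have u := EuclideanSpace.basisFun (Fin d) ℂ
  refine ⟨⟨_, dephase_wernerState_mem_fullyClassical hd ht0 ht1 u,
    relativeEntropy_wernerState_dephase hd ht0 ht1 u⟩, ?_⟩
  rintro _ ⟨σ, hσ, rfl⟩
  exact discord_le_relativeEntropy hd ht0 ht1 (fullyClassical_subset_quantumClassical _ _ hσ)

theorem isLeast_relativeEntropy_quantumClassical (hd : 2 ≤ d) (ht0 : 0 ≤ t) (ht1 : t ≤ 1) :
    IsLeast (relativeEntropy (wernerState d t) '' quantumClassical (Fin d) (Fin d))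
      (discord (wernerState d t) : EReal) := by
  refine ⟨Set.image_mono (fullyClassical_subset_quantumClassical _ _)
    (isLeast_relativeEntropy_fullyClassical hd ht0 ht1).1, ?_⟩
  rintro _ ⟨σ, hσ, rfl⟩
  exact discord_le_relativeEntropy hd ht0 ht1 hσ

end RelativeEntropy

end QuantumCorrelations

/-! ### Assembly of the statement -/

open QuantumCorrelations in
theorem mainTheorem1 (d : ℕ) (hd : 2 ≤ d) (t : ℝ) (ht0 : 0 ≤ t) (ht1 : t ≤ 1) :
    IsDensity (wernerState d t) ∧
    -- every rank-one POVM of Bob gives the same conditional entropy, outcome by outcome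
    (∀ (N : ℕ) (E : Fin N → Matrix (Fin d) (Fin d) ℂ), IsRankOnePOVM E →
      (∀ k, entropy (condState (wernerState d t) (E k)) =
        -(2 * (1 - t) / (d + 1)) * Real.logb 2 (2 * (1 - t) / (d + 1))
          - (d - 1 + 2 * t) / (d + 1) * Real.logb 2 ((d - 1 + 2 * t) / (d ^ 2 - 1))) ∧
      condEntropy (wernerState d t) E =
        -(2 * (1 - t) / (d + 1)) * Real.logb 2 (2 * (1 - t) / (d + 1))
          - (d - 1 + 2 * t) / (d + 1) * Real.logb 2 ((d - 1 + 2 * t) / (d ^ 2 - 1)) ∧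
      -- and this value is the minimum over all POVMs of Bob
      (∀ (N' : ℕ) (E' : Fin N' → Matrix (Fin d) (Fin d) ℂ), IsPOVM E' →
        condEntropy (wernerState d t) E ≤ condEntropy (wernerState d t) E')) ∧
    -- if Bob projects into an orthonormal basis, Alice's conditional states are diagonal in it
    (∀ (u : OrthonormalBasis (Fin d) ℂ (EuclideanSpace ℂ (Fin d))) (k : Fin d),
      IsDiagonalIn u (condState (wernerState d t) (basisProj u k))) ∧
    -- the maximum over the POVMs is attained, and the discord has a closed form
    IsGreatest (classicalCorrelationValues (wernerState d t))
      (classicalCorrelations (wernerState d t)) ∧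
    discord (wernerState d t) =
      Real.logb 2 (d + 1) + t * Real.logb 2 (t / (d - 1))
        + (1 - t) * Real.logb 2 ((1 - t) / (d + 1))
        - 2 * (1 - t) / (d + 1) * Real.logb 2 (1 - t)
        - (d - 1 + 2 * t) / (d + 1) * Real.logb 2 ((d - 1 + 2 * t) / (2 * (d - 1))) ∧
    -- the other measures are attained minima and coincide with the discord
    IsLeast (midValues (wernerState d t)) (measurementInducedDisturbance (wernerState d t)) ∧
    measurementInducedDisturbance (wernerState d t) = discord (wernerState d t) ∧
    (∀ u : OrthonormalBasis (Fin d) ℂ (EuclideanSpace ℂ (Fin d)),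
      mutualInfo (wernerState d t) - mutualInfo (dephase u u (wernerState d t)) =
        discord (wernerState d t)) ∧
    IsLeast (relativeEntropy (wernerState d t) '' quantumClassical (Fin d) (Fin d))
      (oneSidedREQ (wernerState d t)) ∧
    oneSidedREQ (wernerState d t) = (discord (wernerState d t) : EReal) ∧
    IsLeast (relativeEntropy (wernerState d t) '' fullyClassical (Fin d) (Fin d))
      (fullREQ (wernerState d t)) ∧
    fullREQ (wernerState d t) = (discord (wernerState d t) : EReal) := by

  have hC := isGreatest_classicalCorrelationValues hd ht0 ht1
  have hM := isLeast_midValues hd ht0 ht1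
  have hQ := isLeast_relativeEntropy_quantumClassical hd ht0 ht1
  have hF := isLeast_relativeEntropy_fullyClassical hd ht0 ht1
  have eC : classicalCorrelations (wernerState d t) = Real.logb 2 d - minCondEntropy d t :=
    hC.csSup_eq
  have eM : measurementInducedDisturbance (wernerState d t) = discord (wernerState d t) :=
    hM.csInf_eq
  have eQ : oneSidedREQ (wernerState d t) = (discord (wernerState d t) : EReal) := hQ.csInf_eq
  have eF : fullREQ (wernerState d t) = (discord (wernerState d t) : EReal) := hF.csInf_eq
  refine ⟨isDensity_wernerState hd ht0 ht1, fun N E hE => ⟨fun k => ?_, ?_, fun N' E' hE' => ?_⟩,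
    isDiagonalIn_condState_wernerState hd t, eC ▸ hC,
    discord_wernerState_closed_form hd ht0 ht1, eM.symm ▸ hM, eM,
    mutualInfo_sub_mutualInfo_dephase_self hd ht0 ht1, eQ.symm ▸ hQ, eQ, eF.symm ▸ hF, eF⟩
  · rw [entropy_condState_of_rank_eq_one hd t (hE.1.1 k) (hE.2 k), minCondEntropy_eq hd]
  · rw [condEntropy_of_isRankOnePOVM hd t hE, minCondEntropy_eq hd]
  · rw [condEntropy_of_isRankOnePOVM hd t hE]
    exact minCondEntropy_le_condEntropy hd ht0 ht1 hE'
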